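/- Let $d\ge 1$ and let $(X_t)_{t\in\mathbb Z}$ be a strictly stationary sequence of $\mathbb R^d$-valued random vectors on a probability space. Write $|\cdot|$ for the Euclidean norm, $\overline{\mathbb R}{}^{q}_0=[-\infty,\infty]^q\setminus\{0\}$, $\mathbb C_K^+$ for the non-negative continuous functions with compact support on $\overline{\mathbb R}{}^d_0$, $\varepsilon_x$ for the unit mass at $x$, and $M_{s,t}=\max_{s\le i\le t}|X_i|$ (with $M_{s,t}=0$ if $s>t$). Vague convergence $\stackrel{v}{\to}$ of Radon measures means convergence of the integrals of all non-negative continuous functions with compact support. Let $(m_n)$ be a sequence of non-negative integers with $m_n\to\infty$ and $k_n=\lfloor n/m_n\rfloor\to\infty$. Let $(a_n)$ be a real sequence, and define the random measures on $\overline{\mathbb R}{}^d_0$ $$N_{nj}=k_n^{-1}\sum_{t=1}^{j}\varepsilon_{X_t/a_{m_n}}\quad(1\le j\le n),\qquad N_n=N_{nn},$$ where points at the origin are ignored. Assume the following. 1. (Regular variation.) $n\,\mathbb P(|X_0|>a_n)\to 1$, and there is $\alpha>0$ such that for every $k\ge 1$ there is a non-null Radon measure $\mu$ on $\overline{\mathbb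 R}{}^{dk}_0$ with $\mu(uA)=u^{-\alpha}\mu(A)$ for all $u>0$ and all Borel sets $A$, and $n\,\mathbb P(a_n^{-1}(X_1,\dots,X_k)\in\cdot)\stackrel{v}{\to}\mu$ as $n\to\infty$. 2. (Mixing.) For every $f\in\mathbb C_K^+$, $$\mathbb E\,e^{-\int f\,dN_n}-\Big(\mathbb E\,e^{-\int f\,dN_{n,m_n}}\Big)^{k_n}\to 0,\qquad n\to\infty.$$ 3. (Anti-clustering at the levels $a_n$.) There are non-negative integers $l_n$ with $k_n\,l_{m_n}/m_n\to\infty$ such that $$\lim_{k\to\infty}\limsup_{n\to\infty}\mathbb P\big(M_{k,l_n}>\delta a_n\,\big|\,|X_0|>\delta a_n\big)=0,\qquad \delta>0.$$ Then there is a Radon measure $\mu_1$ on $\overline{\mathbb R}{}^d_0$ with $n\,\mathbb P(a_n^{-1}X_0\in\cdot)\stackrel{v}{\to}\mu_1$, and $N_n\to\mu_1$ in probability in the space of Radon measures on $\overline{\mathbb R}{}^d_0$ equipped with the vague topology; that is, $\mathbb P(N_n\notin U)\to 0$ for every vague neighbourhood $U$ of $\mu_1$. -/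

import Mathlib

open MeasureTheory ProbabilityTheory Filter Topology
open scoped ENNReal NNReal CompactlySupported

noncomputable section

namespace TailEmpirical

/-- The punctured compactified space `[-∞, ∞]^ι ∖ {0}`. Its compact subsets are the closed subsets
that stay away from the origin. -/
abbrev Punctured (ι : Type*) : Type _ := {x : ι → EReal // x ≠ 0}

/-- The Radon measures on a locally compact second countable Hausdorff space: the Borel measures
that are finite on compact sets. -/
def RadonMeasure (E : Type*) [TopologicalSpace E] [MeasurableSpace E] : Type _ :=
  {ν : Measure E // IsFiniteMeasureOnCompacts ν}

/-- The vague topology: the coarsest topology for which `ν ↦ ∫ f dν` is continuous for every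
non-negative continuous function `f` with compact support. -/
instance vagueTopology (E : Type*) [TopologicalSpace E] [MeasurableSpace E] :
    TopologicalSpace (RadonMeasure E) :=
  TopologicalSpace.induced (fun ν (f : C_c(E, ℝ≥0)) => ∫ x, (f x : ℝ) ∂ν.1) inferInstance

/-- A vector of `ℝ^ι`, seen in `[-∞, ∞]^ι`. -/
def toExt {ι : Type*} (v : ι → ℝ) : ι → EReal := fun i => (v i : EReal)

/-- The restriction to `[-∞, ∞]^ι ∖ {0}` of a finite measure on `[-∞, ∞]^ι`. -/
def puncture {ι : Type*} [Finite ι] (ν : Measure (ι → EReal)) [IsFiniteMeasure ν] :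
    RadonMeasure (Punctured ι) :=
  ⟨ν.comap Subtype.val, inferInstance⟩

variable {Ω : Type*} [MeasurableSpace Ω]

/-- The measure `c * ℙ(s⁻¹ V ∈ ·)` on `[-∞, ∞]^ι ∖ {0}`, for a random vector `V`. -/
def scaledLaw {ι : Type*} [Finite ι] (P : Measure Ω) [IsProbabilityMeasure P] (V : Ω → ι → ℝ)
    (c : ℝ≥0) (s : ℝ) : RadonMeasure (Punctured ι) :=
  puncture (c • P.map (fun ω => toExt (s⁻¹ • V ω)))

/-- Strict stationarity: the law of the whole process is invariant under time shifts. -/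
def StrictlyStationary {d : ℕ} (P : Measure Ω) (X : ℤ → Ω → EuclideanSpace ℝ (Fin d)) : Prop :=
  ∀ h : ℤ, P.map (fun ω t => X (t + h) ω) = P.map (fun ω t => X t ω)

/-- The lagged vector `(X_1, …, X_k)`, a random vector of `ℝ^{kd}`. -/
def lagged {d : ℕ} (X : ℤ → Ω → EuclideanSpace ℝ (Fin d)) (k : ℕ) :
    Ω → (Fin k × Fin d → ℝ) :=
  fun ω p => X ((p.1 : ℕ) + 1) ω p.2

/-- `μ(u A) = u^{-α} μ(A)` for all `u > 0` and all Borel sets `A`. -/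
def Homogeneous {ι : Type*} (α : ℝ) (μ : RadonMeasure (Punctured ι)) : Prop :=
  ∀ u : ℝ, 0 < u → ∀ A : Set (Punctured ι), MeasurableSet A →
    μ.1 {x | ∃ y ∈ A, ∀ i, x.1 i = (u : EReal) * y.1 i} = ENNReal.ofReal (u ^ (-α)) * μ.1 A

/-- The sequence `(X_t)` is regularly varying with index `α`, with normalizing sequence `(a_n)`:
`n ℙ(|X_0| > a_n) → 1`, and for every `k ≥ 1` the measures `n ℙ(a_n⁻¹ (X_1, …, X_k) ∈ ·)` converge
vaguely to a non-null Radon measure which is homogeneous of degree `-α`. -/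
def RegularlyVarying {d : ℕ} (P : Measure Ω) [IsProbabilityMeasure P]
    (X : ℤ → Ω → EuclideanSpace ℝ (Fin d)) (α : ℝ) (a : ℕ → ℝ) : Prop :=
  Tendsto (fun n : ℕ => (n : ℝ) * P.real {ω | a n < ‖X 0 ω‖}) atTop (𝓝 1) ∧
  ∀ k : ℕ, 1 ≤ k → ∃ μ : RadonMeasure (Punctured (Fin k × Fin d)),
    μ.1 ≠ 0 ∧ Homogeneous α μ ∧
    Tendsto (fun n : ℕ => scaledLaw P (lagged X k) n (a n)) atTop (𝓝 μ)

/-- `M_{s,t} = max_{s ≤ i ≤ t} |X_i|` (and `0` if `s > t`). -/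
def runMax {d : ℕ} (X : ℤ → Ω → EuclideanSpace ℝ (Fin d)) (s t : ℕ) (ω : Ω) : ℝ :=
  ((Finset.Icc s t).sup (fun i : ℕ => ‖X i ω‖₊) : ℝ≥0)

/-- Anti-clustering at the levels `a_n` over the horizons `l_n`:
`lim_{k → ∞} limsup_{n → ∞} ℙ(M_{k, l_n} > δ a_n ∣ |X_0| > δ a_n) = 0` for every `δ > 0`. -/
def AntiClustering {d : ℕ} (P : Measure Ω) (X : ℤ → Ω → EuclideanSpace ℝ (Fin d))
    (a : ℕ → ℝ) (l : ℕ → ℕ) : Prop :=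
  ∀ δ : ℝ, 0 < δ →
    Tendsto (fun k : ℕ => limsup (fun n : ℕ =>
      P[|{ω | δ * a n < ‖X 0 ω‖}] {ω | δ * a n < runMax X k (l n) ω}) atTop) atTop (𝓝 0)

/-- The random measure `c⁻¹ ∑_{t=1}^j ε_{s⁻¹ X_t}` on `[-∞, ∞]^d ∖ {0}`; here `ε_x` is the Dirac
measure at `x`, and points at the origin do not count. -/
def empirical {d : ℕ} (X : ℤ → Ω → EuclideanSpace ℝ (Fin d)) (c : ℕ) (s : ℝ) (j : ℕ) (ω : Ω) :
    RadonMeasure (Punctured (Fin d)) :=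
  puncture ((c : ℝ≥0)⁻¹ • ∑ t ∈ Finset.Icc 1 j, Measure.dirac (toExt (s⁻¹ • ⇑(X (t : ℤ) ω))))

/-- `N_{nj} = k_n⁻¹ ∑_{t=1}^j ε_{X_t / a_m}`, where `m = m_n` and `k_n = ⌊n / m_n⌋`. -/
def tailEmpirical {d : ℕ} (X : ℤ → Ω → EuclideanSpace ℝ (Fin d)) (a : ℕ → ℝ) (m : ℕ → ℕ)
    (n j : ℕ) : Ω → RadonMeasure (Punctured (Fin d)) :=
  empirical X (n / m n) (a (m n)) j

/-- The mixing condition for the random measures `N_{nj}`: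
`𝔼 exp(-∫ f dN_{nn}) - (𝔼 exp(-∫ f dN_{n,m_n}))^{k_n} → 0`
for every non-negative continuous `f` with compact support. -/
def Mixing {d : ℕ} (P : Measure Ω) (X : ℤ → Ω → EuclideanSpace ℝ (Fin d)) (a : ℕ → ℝ)
    (m : ℕ → ℕ) : Prop :=
  ∀ f : C_c(Punctured (Fin d), ℝ≥0), Tendsto (fun n : ℕ =>
    (∫ ω, Real.exp (-∫ x, (f x : ℝ) ∂(tailEmpirical X a m n n ω).1) ∂P) -
    (∫ ω, Real.exp (-∫ x, (f x : ℝ) ∂(tailEmpirical X a m n (m n) ω).1) ∂P) ^ (n / m n))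
    atTop (𝓝 0)

/-- Convergence in probability of random elements of a topological space to a constant. For a
metrizable space this is the usual notion. -/
def ConvergesInProbability {S : Type*} [TopologicalSpace S] (P : Measure Ω)
    (N : ℕ → Ω → S) (μ : S) : Prop :=
  ∀ U ∈ 𝓝 μ, Tendsto (fun n => P {ω | N n ω ∉ U}) atTop (𝓝 0)

end TailEmpirical

end

namespace TailEmpirical

/-! A vague neighbourhood constrains finitely many integrals, so it is enough that Y_n = ∫ f dN_n
tends in probability to c = ∫ f dμ₁ for each test function f. As c is constant, the Laplace
transform of Y_n at 1 and 2 decides this (`tendsto_measure_of_laplace`). By mixing, that transform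
is close to the k-th power of its value on one block, so everything reduces to k(1 - E e^{-S/k}) → c
(`tendsto_mul_one_sub_laplace`), where S sums f(X_t / a_m) over one block of length m. Stationarity
and the vague convergence of the one-point laws give E S → c.

The bound k(1 - E e^{-S/k}) ≤ E S is 1 - e^{-x} ≤ x. The converse rests on `sum_sub_le_of_gap`.
Exceedances followed by another one at a lag in [q, l] have small expected number, by
anti-clustering. The others number at most q(m/l + 1), which is o(k) because kl/m → ∞ and k → ∞.
Their part G of the sum thus has G/k uniformly small, and the quadratic error G²/k is negligible
against G. -/

/-- The extension by zero to `[-∞, ∞]^ι` of a function on the punctured space. -/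
noncomputable def extendZero {ι : Type*} (f : C_c(Punctured ι, ℝ≥0)) : (ι → EReal) → ℝ :=
  Function.extend Subtype.val (fun x => (f x : ℝ)) 0

/-! ### Test functions on the uncompactified side: extension by zero at the origin. -/

section extendZero

variable {ι : Type*} (f : C_c(Punctured ι, ℝ≥0))

lemma extendZero_coe (x : Punctured ι) : extendZero f x.1 = f x :=
  Subtype.val_injective.extend_apply _ _ _

lemma extendZero_zero : extendZero f 0 = 0 :=
  Function.extend_apply' _ _ _ (by rintro ⟨x, hx⟩; exact x.2 hx)

lemma extendZero_nonneg (y : ι → EReal) : 0 ≤ extendZero f y := by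
  by_cases hy : y = 0
  · rw [hy, extendZero_zero]
  · rw [extendZero_coe f ⟨y, hy⟩]; positivity

lemma exists_extendZero_le : ∃ C : ℝ, 0 ≤ C ∧ ∀ y, extendZero f y ≤ C := by
  have hc : HasCompactSupport fun x => (f x : ℝ) :=
    HasCompactSupport.comp_left (g := NNReal.toReal) f.hasCompactSupport' NNReal.coe_zero
  obtain ⟨C, hC⟩ := hc.exists_bound_of_continuous
    (NNReal.continuous_coe.comp f.continuous)
  refine ⟨max C 0, le_max_right _ _, fun y => ?_⟩
  by_cases hy : y = 0
  · rw [hy, extendZero_zero]; exact le_max_right _ _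
  · rw [extendZero_coe f ⟨y, hy⟩]
    exact le_max_of_le_left (by simpa using hC ⟨y, hy⟩)

lemma measurable_extendZero [Finite ι] : Measurable (extendZero f) := by
  refine (MeasurableEmbedding.subtype_coe ?_).measurable_extend
    (f.continuous.measurable.coe_nnreal_real) measurable_const
  exact (measurableSet_singleton (0 : ι → EReal)).compl

/-- The extension vanishes at the origin, so a mass there is invisible; later integrals can ignore
the puncture. -/
lemma integral_puncture [Finite ι] (ν : Measure (ι → EReal)) [IsFiniteMeasure ν] :
    ∫ x, (f x : ℝ) ∂(puncture ν).1 = ∫ y, extendZero f y ∂ν := by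
  have hs : MeasurableSet {x : ι → EReal | x ≠ 0} :=
    (measurableSet_singleton (0 : ι → EReal)).compl
  have h := integral_subtype_comap (μ := ν) hs (extendZero f)
  simp only [extendZero_coe] at h
  refine h.trans (setIntegral_eq_integral_of_forall_compl_eq_zero fun y hy => ?_)
  rw [show y = 0 by simpa using hy, extendZero_zero]

end extendZero

/-! ### Compact support versus the Euclidean norm. -/

lemma continuous_toExt {ι : Type*} : Continuous (toExt : (ι → ℝ) → ι → EReal) :=
  continuous_pi fun i => continuous_coe_real_ereal.comp (continuous_apply i)

lemma toExt_zero {ι : Type*} : toExt (0 : ι → ℝ) = 0 := by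
  ext i; simp [toExt]

lemma isInducing_toExt {ι : Type*} : IsInducing (toExt : (ι → ℝ) → ι → EReal) :=
  IsInducing.piMap fun _ => EReal.isEmbedding_coe.isInducing

lemma measurable_toExt {ι : Type*} [Finite ι] : Measurable (toExt : (ι → ℝ) → ι → EReal) :=
  continuous_toExt.measurable

lemma measurable_ofLp {Ω : Type*} [MeasurableSpace Ω] {d : ℕ} {V : Ω → EuclideanSpace ℝ (Fin d)}
    (hV : Measurable V) : Measurable fun ω => (⇑(V ω) : Fin d → ℝ) :=
  (PiLp.homeomorph 2 (fun _ : Fin d => ℝ)).continuous.measurable.comp hV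

/-- Dictionary between the two topologies near 0: it turns "away from the origin in the
compactification" into a lower bound on the norm. -/
lemma nhds_zero_eq_comap_toExt (d : ℕ) :
    𝓝 (0 : EuclideanSpace ℝ (Fin d)) =
      comap (fun v : EuclideanSpace ℝ (Fin d) => toExt (⇑v)) (𝓝 0) := by
  have h : IsInducing (fun v : EuclideanSpace ℝ (Fin d) => toExt (⇑v)) :=
    isInducing_toExt.comp (PiLp.homeomorph 2 (fun _ : Fin d => ℝ)).isInducing
  rw [h.nhds_eq_comap, ← toExt_zero]
  rfl

/-- Functions with compact support vanish near the origin. -/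
lemma exists_lt_norm_of_extendZero_ne_zero {d : ℕ} (f : C_c(Punctured (Fin d), ℝ≥0)) :
    ∃ δ : ℝ, 0 < δ ∧ ∀ v : EuclideanSpace ℝ (Fin d), extendZero f (toExt ⇑v) ≠ 0 → δ < ‖v‖ := by
  have hK : IsCompact (Subtype.val '' tsupport (fun x => f x)) :=
    IsCompact.image f.hasCompactSupport' continuous_subtype_val
  have hU : (Subtype.val '' tsupport (fun x => f x))ᶜ ∈ 𝓝 (0 : Fin d → EReal) := by
    refine hK.isClosed.isOpen_compl.mem_nhds ?_
    rintro ⟨x, -, hx⟩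
    exact x.2 hx
  have hV := preimage_mem_comap (m := fun v : EuclideanSpace ℝ (Fin d) => toExt (⇑v)) hU
  rw [← nhds_zero_eq_comap_toExt] at hV
  obtain ⟨δ, hδ, hball⟩ := Metric.mem_nhds_iff.1 hV
  refine ⟨δ / 2, half_pos hδ, fun v hv => ?_⟩
  by_contra! hle
  refine hball (show v ∈ Metric.ball 0 δ by simpa using by linarith) ?_
  have hne : toExt (⇑v) ≠ 0 := fun h => hv (by rw [h, extendZero_zero])
  refine ⟨⟨_, hne⟩, subset_tsupport _ ?_, rfl⟩
  intro h
  apply hv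
  rw [extendZero_coe f ⟨_, hne⟩]
  simpa using h

instance {ι : Type*} : LocallyCompactSpace (Punctured ι) :=
  (isOpen_compl_singleton (x := (0 : ι → EReal))).locallyCompactSpace

/-- The complement of a ball is dominated by a continuous function with compact support. -/
lemma exists_one_le_extendZero {d : ℕ} {δ : ℝ} (hδ : 0 < δ) :
    ∃ f : C_c(Punctured (Fin d), ℝ≥0), ∀ v : EuclideanSpace ℝ (Fin d), δ < ‖v‖ →
      1 ≤ extendZero f (toExt ⇑v) := by
  have hball : Metric.ball (0 : EuclideanSpace ℝ (Fin d)) δ ∈ 𝓝 0 := Metric.ball_mem_nhds _ hδ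
  rw [nhds_zero_eq_comap_toExt] at hball
  obtain ⟨U, hU, hUball⟩ := hball
  obtain ⟨V, hVU, hV, hV0⟩ := mem_nhds_iff.1 hU
  -- The complement of `V` is closed in a compact cube and misses the origin, so it stays compact
  -- after puncturing.
  have hK : IsCompact (Subtype.val ⁻¹' Vᶜ : Set (Punctured (Fin d))) := by
    rw [Subtype.isCompact_iff, Set.image_preimage_eq_inter_range, Subtype.range_coe_subtype]
    refine IsClosed.isCompact ?_
    convert hV.isClosed_compl using 1
    ext x
    exact and_iff_left_of_imp fun hx h => hx (h ▸ hV0)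
  obtain ⟨g, hg1, -, hgc, hg01⟩ :=
    exists_continuous_one_zero_of_isCompact hK isClosed_empty (Set.disjoint_empty _)
  refine ⟨⟨⟨fun x => (g x).toNNReal, continuous_real_toNNReal.comp g.continuous⟩,
    hgc.comp_left Real.toNNReal_zero⟩, fun v hv => ?_⟩
  have hnV : toExt (⇑v) ∉ V := fun h => by
    have := hUball (hVU h)
    simp only [mem_ball_zero_iff] at this
    linarith
  have hne : toExt (⇑v) ≠ 0 := fun h => hnV (h ▸ hV0)
  rw [extendZero_coe _ ⟨_, hne⟩]
  have h1 : g ⟨_, hne⟩ = 1 := hg1 hnV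
  change (1 : ℝ) ≤ ((g ⟨_, hne⟩).toNNReal : ℝ)
  rw [h1]; simp

/-! ### The vague topology through test functions. -/

lemma tendsto_radonMeasure_iff {E β : Type*} [TopologicalSpace E] [MeasurableSpace E]
    {l : Filter β} {ν : β → RadonMeasure E} {μ : RadonMeasure E} :
    Tendsto ν l (𝓝 μ) ↔ ∀ f : C_c(E, ℝ≥0),
      Tendsto (fun b => ∫ x, (f x : ℝ) ∂(ν b).1) l (𝓝 (∫ x, (f x : ℝ) ∂μ.1)) := by
  have h : IsInducing (fun (ν : RadonMeasure E) (f : C_c(E, ℝ≥0)) => ∫ x, (f x : ℝ) ∂ν.1) := ⟨rfl⟩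
  exact h.tendsto_nhds_iff.trans tendsto_pi_nhds

/-- Convergence in probability in the vague topology follows from convergence in probability of
the integrals of all test functions. -/
lemma convergesInProbability_of_integral {Ω E : Type*} [MeasurableSpace Ω] [TopologicalSpace E]
    [MeasurableSpace E] {P : Measure Ω} {N : ℕ → Ω → RadonMeasure E} {μ : RadonMeasure E}
    (h : ∀ (f : C_c(E, ℝ≥0)) (ε : ℝ), 0 < ε → Tendsto (fun n =>
      P {ω | ε ≤ |∫ x, (f x : ℝ) ∂(N n ω).1 - ∫ x, (f x : ℝ) ∂μ.1|}) atTop (𝓝 0)) :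
    ConvergesInProbability P N μ := by
  intro U hU
  rw [nhds_induced, mem_comap] at hU
  obtain ⟨W, hW, hWU⟩ := hU
  -- Only finitely many coordinates of the product matter, so a union bound suffices.
  rw [nhds_pi, Filter.mem_pi] at hW
  obtain ⟨I, hI, t, ht, htW⟩ := hW
  have hε : ∀ f, ∃ ε > 0, Metric.ball (∫ x, (f x : ℝ) ∂μ.1) ε ⊆ t f :=
    fun f => Metric.mem_nhds_iff.1 (ht f)
  choose ε hε0 hεt using hε
  have hsum : Tendsto (fun n => ∑ f ∈ hI.toFinset,
      P {ω | ε f ≤ |∫ x, (f x : ℝ) ∂(N n ω).1 - ∫ x, (f x : ℝ) ∂μ.1|}) atTop (𝓝 0) := by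
    simpa using tendsto_finsetSum hI.toFinset fun f _ => h f (ε f) (hε0 f)
  refine tendsto_of_tendsto_of_tendsto_of_le_of_le tendsto_const_nhds hsum
    (fun n => bot_le) fun n => ?_
  refine (measure_mono fun ω hω => ?_).trans (measure_biUnion_finset_le hI.toFinset _)
  by_contra hcon
  simp only [Set.Finite.mem_toFinset, Set.mem_iUnion, Set.mem_ofPred_eq, exists_prop, not_exists,
    not_and, not_le] at hcon
  refine hω (hWU (htW fun f hf => hεt f ?_))
  rw [Metric.mem_ball, Real.dist_eq]
  exact hcon f hf

/-! ### Transport of measures; integrals against empirical measures and scaled laws. -/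

/-- Transport of a Radon measure along a homeomorphism. -/
noncomputable def RadonMeasure.map {E F : Type*} [TopologicalSpace E] [MeasurableSpace E]
    [BorelSpace E] [TopologicalSpace F] [MeasurableSpace F] [BorelSpace F] (e : E ≃ₜ F)
    (μ : RadonMeasure E) : RadonMeasure F :=
  ⟨μ.1.map e, ⟨fun K hK => by
    rw [e.measurableEmbedding.map_apply]
    exact μ.2.lt_top_of_isCompact (e.isCompact_preimage.2 hK)⟩⟩

/-- Reindexing of the coordinates of the punctured space. -/
def puncturedReindex {ι κ : Type*} (e : ι ≃ κ) : Punctured ι ≃ₜ Punctured κ where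
  toFun x := ⟨fun j => x.1 (e.symm j), fun h => x.2 (by ext i; simpa using congrFun h (e i))⟩
  invFun y := ⟨fun i => y.1 (e i), fun h => y.2 (by ext j; simpa using congrFun h (e.symm j))⟩
  left_inv x := by ext; simp
  right_inv y := by ext; simp
  continuous_toFun := by
    refine Continuous.subtype_mk (continuous_pi fun j => ?_) _
    exact (continuous_apply _).comp continuous_subtype_val
  continuous_invFun := by
    refine Continuous.subtype_mk (continuous_pi fun j => ?_) _
    exact (continuous_apply _).comp continuous_subtype_val

lemma integral_empirical {Ω : Type*} {d : ℕ} (X : ℤ → Ω → EuclideanSpace ℝ (Fin d)) (c : ℕ)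
    (s : ℝ) (j : ℕ) (ω : Ω) (f : C_c(Punctured (Fin d), ℝ≥0)) :
    ∫ x, (f x : ℝ) ∂(empirical X c s j ω).1 =
      (c : ℝ)⁻¹ * ∑ t ∈ Finset.Icc 1 j, extendZero f (toExt (s⁻¹ • ⇑(X (t : ℤ) ω))) := by
  have hsm := (measurable_extendZero f).stronglyMeasurable
  rw [empirical, integral_puncture, integral_smul_nnreal_measure, integral_finsetSum_measure]
  · simp_rw [integral_dirac' _ _ hsm]
    simp [NNReal.smul_def]
  · intro i _
    exact integrable_dirac' hsm (by simp)

section scaledLaw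

variable {Ω : Type*} [MeasurableSpace Ω] (P : Measure Ω) [IsProbabilityMeasure P]

lemma integral_scaledLaw {ι : Type*} [Finite ι] {V : Ω → ι → ℝ} (hV : Measurable V) (c : ℝ≥0)
    (s : ℝ) (f : C_c(Punctured ι, ℝ≥0)) :
    ∫ x, (f x : ℝ) ∂(scaledLaw P V c s).1 = c * ∫ ω, extendZero f (toExt (s⁻¹ • V ω)) ∂P := by
  have hm : Measurable fun ω => toExt (s⁻¹ • V ω) :=
    measurable_toExt.comp (hV.const_smul s⁻¹)
  rw [scaledLaw, integral_puncture, integral_smul_nnreal_measure, integral_map hm.aemeasurable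
    (measurable_extendZero f).aestronglyMeasurable]
  rfl

/-- The vague limit of the laws `n ℙ(a_n⁻¹ X_0 ∈ ·)`, obtained from the lagged vectors of
length one. -/
lemma exists_tendsto_scaledLaw {d : ℕ} (X : ℤ → Ω → EuclideanSpace ℝ (Fin d))
    (hX : ∀ t, Measurable (X t)) (h01 : P.map (X 1) = P.map (X 0)) (a : ℕ → ℝ)
    {μ : RadonMeasure (Punctured (Fin 1 × Fin d))}
    (hμ : Tendsto (fun n : ℕ => scaledLaw P (lagged X 1) n (a n)) atTop (𝓝 μ)) :
    ∃ μ₁ : RadonMeasure (Punctured (Fin d)),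
      Tendsto (fun n : ℕ => scaledLaw P (fun ω => ⇑(X 0 ω)) n (a n)) atTop (𝓝 μ₁) := by
  let e : Punctured (Fin 1 × Fin d) ≃ₜ Punctured (Fin d) :=
    puncturedReindex (Equiv.uniqueProd (Fin d) (Fin 1))
  refine ⟨μ.map e, tendsto_radonMeasure_iff.2 fun f => ?_⟩
  let g : C_c(Punctured (Fin 1 × Fin d), ℝ≥0) :=
    ⟨⟨fun x => f (e x), f.continuous.comp e.continuous⟩,
      f.hasCompactSupport'.comp_homeomorph e⟩
  have hg := tendsto_radonMeasure_iff.1 hμ g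
  have hlim : ∫ x, (f x : ℝ) ∂(μ.map e).1 = ∫ x, (g x : ℝ) ∂μ.1 :=
    e.measurableEmbedding.integral_map _
  rw [hlim]
  refine hg.congr fun n => ?_
  have hlag : Measurable (lagged X 1) :=
    measurable_pi_lambda _ fun p => (measurable_pi_apply p.2).comp (measurable_ofLp (hX _))
  rw [integral_scaledLaw P hlag, integral_scaledLaw P (measurable_ofLp (hX 0))]
  congr 1
  let φ : EuclideanSpace ℝ (Fin d) → ℝ := fun v => extendZero f (toExt ((a n)⁻¹ • ⇑v))
  have hφ : Measurable φ := (measurable_extendZero f).comp (measurable_toExt.comp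
    ((measurable_ofLp measurable_id).const_smul (a n)⁻¹))
  have hgf : ∀ y : Fin 1 × Fin d → EReal,
      extendZero g y = extendZero f (fun j => y (0, j)) := by
    intro y
    by_cases hy : y = 0
    · subst hy
      rw [extendZero_zero]
      exact (extendZero_zero f).symm
    · rw [extendZero_coe g ⟨y, hy⟩]
      exact (extendZero_coe f (e ⟨y, hy⟩)).symm
  -- The lagged vector starts at time 1, whence the detour through the law of `X 1`.
  calc ∫ ω, extendZero g (toExt ((a n)⁻¹ • lagged X 1 ω)) ∂P
      = ∫ ω, φ (X 1 ω) ∂P := by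
        refine integral_congr_ae (ae_of_all _ fun ω => ?_)
        simp only [hgf]
        rfl
    _ = ∫ v, φ v ∂(P.map (X 1)) :=
        (integral_map (hX 1).aemeasurable hφ.aestronglyMeasurable).symm
    _ = ∫ ω, φ (X 0 ω) ∂P := by
        rw [h01, integral_map (hX 0).aemeasurable hφ.aestronglyMeasurable]

end scaledLaw

/-! ### Pathwise estimates for exceedances. -/

/-- A set of naturals whose points have no successor in the set at a distance in `[q, l]` has at
most `q` points in each block of length `l`. -/
lemma card_le_of_gap {s : Finset ℕ} {m q l : ℕ} (hl : 0 < l) (hs : ∀ t ∈ s, t ≤ m)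
    (hgap : ∀ t ∈ s, ∀ u ∈ s, ¬ (t + q ≤ u ∧ u ≤ t + l)) : s.card ≤ q * (m / l + 1) := by
  have hmaps : Set.MapsTo (fun t => t / l) s (Finset.range (m / l + 1) : Finset ℕ) := by
    intro t ht
    simpa [Nat.lt_succ_iff] using Nat.div_le_div_right (hs t ht)
  have h := Finset.card_le_mul_card_image_of_maps_to hmaps q ?_
  · simpa using h
  intro b _
  set T := s.filter fun t => t / l = b
  rcases T.eq_empty_or_nonempty with hT | hT
  · simp [hT]
  have hmin := Finset.mem_filter.1 (T.min'_mem hT)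
  -- Points with the same quotient by `l` are less than `l` apart, so the gap condition at the
  -- minimum confines the block to `q` consecutive integers.
  have hsub : T ⊆ Finset.Ico (T.min' hT) (T.min' hT + q) := by
    intro u hu
    have hu' := Finset.mem_filter.1 hu
    have hle := T.min'_le u hu
    refine Finset.mem_Ico.2 ⟨hle, ?_⟩
    by_contra! hq
    refine hgap _ hmin.1 u hu'.1 ⟨hq, ?_⟩
    have h1 := Nat.div_mul_le_self (T.min' hT) l
    have h2 := Nat.lt_div_mul_add (a := u) hl
    rw [hu'.2] at h2
    rw [hmin.2] at h1
    omega
  simpa using Finset.card_le_card hsub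

lemma sub_sq_le_one_sub_exp_neg {x : ℝ} (hx : 0 ≤ x) : x - x ^ 2 ≤ 1 - Real.exp (-x) := by
  have h1 : Real.exp (-x) ≤ (1 + x)⁻¹ := by
    rw [Real.exp_neg]
    exact inv_anti₀ (by linarith) (by linarith [Real.add_one_le_exp x])
  have h2 : (1 + x)⁻¹ ≤ 1 - x + x ^ 2 := by
    rw [inv_le_iff_one_le_mul₀' (by linarith)]
    nlinarith [pow_nonneg hx 3]
  linarith

open Classical in
/-- Comparison of `S` with `k (1 - e^{-S / k})` for a sum `S` over exceedances: exceedances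
followed by another one at a distance in `[q, l]` are counted separately, the remaining ones are
few. -/
lemma sum_sub_le_of_gap (A : ℕ → Prop) (y : ℕ → ℝ) {C r : ℝ} {m q l k : ℕ} (hl : 0 < l)
    (hk : 0 < k) (hC : 0 ≤ C) (hy0 : ∀ t, 0 ≤ y t) (hyC : ∀ t, y t ≤ C)
    (hyA : ∀ t, y t ≠ 0 → A t) (hr : C * (q * (m / l + 1) : ℕ) ≤ r * k) (hr0 : 0 ≤ r) :
    ∑ t ∈ Finset.Icc 1 m, y t
        - k * (1 - Real.exp (-((k : ℝ)⁻¹ * ∑ t ∈ Finset.Icc 1 m, y t))) ≤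
      C * (∑ t ∈ Finset.Icc 1 m, if A t ∧ ∃ i ∈ Finset.Icc (t + q) (t + l), A i then 1 else 0)
        + r * ∑ t ∈ Finset.Icc 1 m, y t := by
  set B : ℕ → Prop := fun t => A t ∧ ∃ i ∈ Finset.Icc (t + q) (t + l), A i
  have hk' : (0 : ℝ) < k := by exact_mod_cast hk
  set S := ∑ t ∈ Finset.Icc 1 m, y t
  -- The contribution of the exceedances with no successor at a lag in [q, l].
  set G := ∑ t ∈ Finset.Icc 1 m, if B t then 0 else y t
  have hG0 : 0 ≤ G := Finset.sum_nonneg fun t _ => by split_ifs <;> simp [hy0]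
  have hGS : G ≤ S := Finset.sum_le_sum fun t _ => by split_ifs <;> simp [hy0]
  have hSG : S ≤ C * (∑ t ∈ Finset.Icc 1 m, if B t then 1 else 0) + G := by
    rw [Finset.mul_sum, ← Finset.sum_add_distrib]
    refine Finset.sum_le_sum fun t _ => ?_
    split_ifs <;> simp [hyC]
  have hGr : G ≤ r * k := by
    refine le_trans ?_ hr
    set s := (Finset.Icc 1 m).filter fun t => A t ∧ ¬ B t
    have hcard : s.card ≤ q * (m / l + 1) := by
      refine card_le_of_gap hl (fun t ht => ?_) fun t ht u hu h => ?_
      · exact (Finset.mem_Icc.1 (Finset.mem_filter.1 ht).1).2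
      · have ht' := (Finset.mem_filter.1 ht).2
        exact ht'.2 ⟨ht'.1, u, Finset.mem_Icc.2 h, (Finset.mem_filter.1 hu).2.1⟩
    calc G ≤ ∑ t ∈ Finset.Icc 1 m, if A t ∧ ¬ B t then C else 0 := by
          refine Finset.sum_le_sum fun t _ => ?_
          by_cases hB : B t
          · simp [hB]
          · by_cases hA : A t
            · simp [hA, hB, hyC]
            · have : y t = 0 := by_contra fun h => hA (hyA t h)
              simp [this, hA]
      _ = C * s.card := by
          rw [← Finset.sum_filter, Finset.sum_const, nsmul_eq_mul, mul_comm]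
      _ ≤ C * (q * (m / l + 1) : ℕ) := by gcongr
  -- The quadratic error is k(G/k)² = (G/k)G, and G/k ≤ r.
  have h1 : G - r * G ≤ k * (1 - Real.exp (-((k : ℝ)⁻¹ * G))) := by
    have hx : 0 ≤ (k : ℝ)⁻¹ * G := by positivity
    have h2 := mul_le_mul_of_nonneg_left (sub_sq_le_one_sub_exp_neg hx) hk'.le
    refine le_trans ?_ h2
    have h3 : (k : ℝ) * ((k : ℝ)⁻¹ * G - ((k : ℝ)⁻¹ * G) ^ 2) = G - (k : ℝ)⁻¹ * G * G := by
      field_simp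
    have h4 : (k : ℝ)⁻¹ * G ≤ r := by
      rw [inv_mul_le_iff₀ hk']; linarith
    rw [h3]
    nlinarith
  have h5 : (k : ℝ) * (1 - Real.exp (-((k : ℝ)⁻¹ * G))) ≤
      k * (1 - Real.exp (-((k : ℝ)⁻¹ * S))) := by gcongr
  have h6 : r * G ≤ r * S := by gcongr
  linarith

/-! ### Limits of Laplace transforms. -/

/-- Since p → 1, the limit of k log p follows by squeezing log p between 1 - 1/p and p - 1. -/
lemma tendsto_pow_exp_neg {β : Type*} {F : Filter β} {p : β → ℝ} {k : β → ℕ} {c : ℝ}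
    (hk : Tendsto k F atTop) (h : Tendsto (fun b => k b * (1 - p b)) F (𝓝 c)) :
    Tendsto (fun b => p b ^ k b) F (𝓝 (Real.exp (-c))) := by
  have hkR : Tendsto (fun b => (k b : ℝ)) F atTop := tendsto_natCast_atTop_atTop.comp hk
  have hp : Tendsto p F (𝓝 1) := by
    have h1 : Tendsto (fun b => 1 - (k b * (1 - p b)) * (k b : ℝ)⁻¹) F (𝓝 (1 - c * 0)) :=
      tendsto_const_nhds.sub (h.mul hkR.inv_tendsto_atTop)
    rw [mul_zero, sub_zero] at h1
    refine h1.congr' ?_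
    filter_upwards [hk.eventually_gt_atTop 0] with b hb
    have : (k b : ℝ) ≠ 0 := by positivity
    field_simp
    ring
  have hpos : ∀ᶠ b in F, 0 < p b := hp.eventually_const_lt one_pos
  have hlog : Tendsto (fun b => k b * Real.log (p b)) F (𝓝 (-c)) := by
    have hlow : Tendsto (fun b => -((k b * (1 - p b)) * (p b)⁻¹)) F (𝓝 (-c)) := by
      simpa using (h.mul (hp.inv₀ one_ne_zero)).neg
    refine tendsto_of_tendsto_of_tendsto_of_le_of_le' hlow h.neg ?_ ?_
    · filter_upwards [hpos] with b hb
      have h1 := Real.one_sub_inv_le_log_of_pos hb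
      calc -((k b * (1 - p b)) * (p b)⁻¹) = k b * (1 - (p b)⁻¹) := by field_simp; ring
        _ ≤ _ := by gcongr
    · filter_upwards [hpos] with b hb
      have h1 := Real.log_le_sub_one_of_pos hb
      calc k b * Real.log (p b) ≤ k b * (p b - 1) := by gcongr
        _ = _ := by ring
  refine ((Real.continuous_exp.tendsto _).comp hlog).congr' ?_
  filter_upwards [hpos] with b hb
  rw [Function.comp_apply, Real.exp_nat_mul, Real.exp_log hb]

/-- Convergence in probability to a constant from convergence of two values of the Laplace
transform. -/
lemma tendsto_measure_of_laplace {Ω : Type*} [MeasurableSpace Ω] {P : Measure Ω}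
    [IsProbabilityMeasure P] {Y : ℕ → Ω → ℝ} (hY : ∀ n, Measurable (Y n))
    (hY0 : ∀ n ω, 0 ≤ Y n ω) {c : ℝ}
    (h1 : Tendsto (fun n => ∫ ω, Real.exp (-Y n ω) ∂P) atTop (𝓝 (Real.exp (-c))))
    (h2 : Tendsto (fun n => ∫ ω, Real.exp (-(2 * Y n ω)) ∂P) atTop (𝓝 (Real.exp (-(2 * c)))))
    {ε : ℝ} (hε : 0 < ε) :
    Tendsto (fun n => P {ω | ε ≤ |Y n ω - c|}) atTop (𝓝 0) := by
  have hint1 : ∀ n, Integrable (fun ω => Real.exp (-Y n ω)) P := fun n =>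
    Integrable.of_bound (by fun_prop) 1 (ae_of_all _ fun ω => by
      simpa [abs_of_pos (Real.exp_pos _)] using hY0 n ω)
  have hint2 : ∀ n, Integrable (fun ω => Real.exp (-(2 * Y n ω))) P := fun n =>
    Integrable.of_bound (by fun_prop) 1 (ae_of_all _ fun ω => by
      simpa [abs_of_pos (Real.exp_pos _)] using hY0 n ω)
  have hexp : ∀ n ω, (Real.exp (-Y n ω) - Real.exp (-c)) ^ 2 =
      Real.exp (-(2 * Y n ω)) - 2 * Real.exp (-c) * Real.exp (-Y n ω) + Real.exp (-(2 * c)) := by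
    intro n ω
    rw [show -(2 * Y n ω) = -Y n ω + -Y n ω by ring, show -(2 * c) = -c + -c by ring,
      Real.exp_add, Real.exp_add]
    ring
  have hint : ∀ n, Integrable (fun ω => (Real.exp (-Y n ω) - Real.exp (-c)) ^ 2) P := fun n => by
    simp_rw [hexp]
    exact ((hint2 n).sub ((hint1 n).const_mul _)).add (integrable_const _)
  -- Expanding the square leaves only the transform at 1 and 2, and the limits cancel.
  have hvar : Tendsto (fun n => ∫ ω, (Real.exp (-Y n ω) - Real.exp (-c)) ^ 2 ∂P) atTop
      (𝓝 0) := by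
    have hlim : Tendsto (fun n => ∫ ω, Real.exp (-(2 * Y n ω)) ∂P
        - 2 * Real.exp (-c) * ∫ ω, Real.exp (-Y n ω) ∂P + Real.exp (-(2 * c))) atTop
        (𝓝 (Real.exp (-(2 * c)) - 2 * Real.exp (-c) * Real.exp (-c) + Real.exp (-(2 * c)))) :=
      (h2.sub (h1.const_mul _)).add_const _
    have h0 : Real.exp (-(2 * c)) - 2 * Real.exp (-c) * Real.exp (-c) + Real.exp (-(2 * c))
        = 0 := by
      rw [show -(2 * c) = -c + -c by ring, Real.exp_add]; ring
    rw [h0] at hlim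
    refine hlim.congr fun n => ?_
    simp_rw [hexp]
    rw [integral_add (f := fun ω => Real.exp (-(2 * Y n ω)) - 2 * Real.exp (-c) * Real.exp (-Y n ω))
      ((hint2 n).sub ((hint1 n).const_mul _)) (integrable_const _),
      integral_sub (hint2 n) ((hint1 n).const_mul _), integral_const_mul]
    simp
  -- The least squared distance from e^{-c} to e^{-y} when |y - c| ≥ ε is reached at y = c + ε; on
  -- the other side, e^ε - 1 ≥ 1 - e^{-ε}.
  set η := (Real.exp (-c) * (1 - Real.exp (-ε))) ^ 2
  have hε1 : 0 < 1 - Real.exp (-ε) := by simpa using hε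
  have hη : 0 < η := by positivity
  have hsub : ∀ n, {ω | ε ≤ |Y n ω - c|} ⊆
      {ω | η ≤ (Real.exp (-Y n ω) - Real.exp (-c)) ^ 2} := by
    intro n ω hω
    simp only [Set.mem_ofPred_eq] at hω ⊢
    rw [← sq_abs (Real.exp (-Y n ω) - Real.exp (-c))]
    refine pow_le_pow_left₀ (by positivity) ?_ 2
    rcases le_abs'.1 hω with h | h
    · refine le_trans ?_ (le_abs_self _)
      have h3 : Real.exp (-c) * Real.exp ε ≤ Real.exp (-Y n ω) := by
        rw [← Real.exp_add]; gcongr; linarith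
      have h4 : 2 ≤ Real.exp ε + Real.exp (-ε) := by
        linarith [Real.add_one_le_exp ε, Real.add_one_le_exp (-ε)]
      nlinarith [Real.exp_pos (-c)]
    · refine le_trans ?_ (neg_le_abs _)
      have h3 : Real.exp (-Y n ω) ≤ Real.exp (-c) * Real.exp (-ε) := by
        rw [← Real.exp_add]; gcongr; linarith
      linarith
  have hreal : Tendsto (fun n => P.real {ω | ε ≤ |Y n ω - c|}) atTop (𝓝 0) := by
    have hb : Tendsto (fun n => η⁻¹ * ∫ ω, (Real.exp (-Y n ω) - Real.exp (-c)) ^ 2 ∂P) atTop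
        (𝓝 0) := by simpa using hvar.const_mul η⁻¹
    refine squeeze_zero (fun _ => measureReal_nonneg) (fun n => ?_) hb
    rw [le_inv_mul_iff₀ hη]
    refine le_trans ?_ (mul_meas_ge_le_integral_of_nonneg
      (ae_of_all _ fun ω => sq_nonneg _) (hint n) η)
    exact mul_le_mul_of_nonneg_left (measureReal_mono (hsub n)) hη.le
  have := (ENNReal.continuous_ofReal.tendsto 0).comp hreal
  simpa [Function.comp_def] using this

/-! ### Consequences of stationarity. -/

section Stationary

variable {Ω : Type*} [MeasurableSpace Ω] {P : Measure Ω} {d : ℕ}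
  {X : ℤ → Ω → EuclideanSpace ℝ (Fin d)}

/-- Stated for functionals of the whole path because the clustering event involves several times at
once. -/
lemma StrictlyStationary.integral_shift (hstat : StrictlyStationary P X)
    (hX : ∀ t, Measurable (X t)) {φ : (ℤ → EuclideanSpace ℝ (Fin d)) → ℝ} (hφ : Measurable φ)
    (h : ℤ) : ∫ ω, φ (fun t => X (t + h) ω) ∂P = ∫ ω, φ (fun t => X t ω) ∂P := by
  rw [← integral_map (f := φ) (φ := fun ω t => X (t + h) ω)
      (measurable_pi_lambda _ fun t => hX (t + h)).aemeasurable hφ.aestronglyMeasurable,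
    ← integral_map (f := φ) (φ := fun ω t => X t ω)
      (measurable_pi_lambda _ fun t => hX t).aemeasurable hφ.aestronglyMeasurable, hstat h]

lemma StrictlyStationary.map_eq (hstat : StrictlyStationary P X)
    (hX : ∀ t, Measurable (X t)) (h : ℤ) : P.map (X h) = P.map (X 0) := by
  have h1 := congrArg (Measure.map fun x : ℤ → EuclideanSpace ℝ (Fin d) => x 0) (hstat h)
  rw [Measure.map_map (measurable_pi_apply 0) (measurable_pi_lambda _ fun t => hX (t + h)),
    Measure.map_map (measurable_pi_apply 0) (measurable_pi_lambda _ fun t => hX t)] at h1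
  simpa [Function.comp_def] using h1

end Stationary

/-- No sign of `s` is needed: s = 0 would evaluate the function at the origin, and otherwise |s| ≥
s. -/
lemma lt_norm_of_extendZero_ne_zero {d : ℕ} {f : C_c(Punctured (Fin d), ℝ≥0)} {δ : ℝ} (hδ : 0 < δ)
    (hf : ∀ v : EuclideanSpace ℝ (Fin d), extendZero f (toExt ⇑v) ≠ 0 → δ < ‖v‖) (s : ℝ)
    (v : EuclideanSpace ℝ (Fin d)) (hv : extendZero f (toExt (s⁻¹ • ⇑v)) ≠ 0) :
    δ * s < ‖v‖ := by
  have h := hf (s⁻¹ • v) hv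
  rw [norm_smul, norm_inv, Real.norm_eq_abs] at h
  have hs : 0 < |s| := by
    rcases eq_or_ne s 0 with rfl | hs
    · simp at h; linarith
    · exact abs_pos.2 hs
  rw [lt_inv_mul_iff₀ hs] at h
  nlinarith [le_abs_self s]

/-! ### Estimates for a single block. -/

section Block

variable {Ω : Type*} [MeasurableSpace Ω] {P : Measure Ω} [IsProbabilityMeasure P] {d : ℕ}
  {X : ℤ → Ω → EuclideanSpace ℝ (Fin d)}

lemma measurable_extendZero_smul (f : C_c(Punctured (Fin d), ℝ≥0)) (s : ℝ) :
    Measurable fun v : EuclideanSpace ℝ (Fin d) => extendZero f (toExt (s⁻¹ • ⇑v)) :=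
  (measurable_extendZero f).comp (measurable_toExt.comp
    ((measurable_ofLp measurable_id).const_smul s⁻¹))

lemma measurable_sum_extendZero (hX : ∀ t, Measurable (X t)) (f : C_c(Punctured (Fin d), ℝ≥0))
    (s : ℝ) (m : ℕ) :
    Measurable fun ω => ∑ t ∈ Finset.Icc 1 m, extendZero f (toExt (s⁻¹ • ⇑(X (t : ℤ) ω))) :=
  Finset.measurable_sum _ fun t _ => (measurable_extendZero_smul f s).comp (hX t)

lemma integrable_extendZero_smul (hX : ∀ t, Measurable (X t))
    (f : C_c(Punctured (Fin d), ℝ≥0)) (s : ℝ) (t : ℤ) :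
    Integrable (fun ω => extendZero f (toExt (s⁻¹ • ⇑(X t ω)))) P := by
  obtain ⟨C, -, hC⟩ := exists_extendZero_le f
  refine Integrable.of_bound
    ((measurable_extendZero_smul f s).comp (hX t)).aestronglyMeasurable C (ae_of_all _ fun ω => ?_)
  rw [Real.norm_of_nonneg (extendZero_nonneg f _)]
  exact hC _

lemma integral_sum_extendZero (hX : ∀ t, Measurable (X t)) (hstat : StrictlyStationary P X)
    (f : C_c(Punctured (Fin d), ℝ≥0)) (s : ℝ) (m : ℕ) :
    ∫ ω, ∑ t ∈ Finset.Icc 1 m, extendZero f (toExt (s⁻¹ • ⇑(X (t : ℤ) ω))) ∂P =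
      ∫ x, (f x : ℝ) ∂(scaledLaw P (fun ω => ⇑(X 0 ω)) m s).1 := by
  rw [integral_finsetSum _ fun (t : ℕ) _ => integrable_extendZero_smul hX f s t,
    integral_scaledLaw P (measurable_ofLp (hX 0))]
  have h : ∀ t : ℕ, ∫ ω, extendZero f (toExt (s⁻¹ • ⇑(X (t : ℤ) ω))) ∂P =
      ∫ ω, extendZero f (toExt (s⁻¹ • ⇑(X 0 ω))) ∂P := fun t => by
    simpa using hstat.integral_shift hX
      ((measurable_extendZero_smul f s).comp (measurable_pi_apply 0)) t
  simp_rw [h]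
  simp

-- The expectation of `sum_sub_le_of_gap`. Stationarity moves each clustering event to time 0, so
-- their expected number is at most `m` times one joint probability.
open Classical in
lemma integral_sub_le_of_block (hX : ∀ t, Measurable (X t)) (hstat : StrictlyStationary P X)
    {f : C_c(Punctured (Fin d), ℝ≥0)} {C δ : ℝ} (hC0 : 0 ≤ C) (hC : ∀ y, extendZero f y ≤ C)
    (hδ : 0 < δ) (hf : ∀ v : EuclideanSpace ℝ (Fin d), extendZero f (toExt ⇑v) ≠ 0 → δ < ‖v‖)
    (s : ℝ) {r : ℝ} {m q l k : ℕ} (hl : 0 < l) (hk : 0 < k)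
    (hr : C * (q * (m / l + 1) : ℕ) ≤ r * k) (hr0 : 0 ≤ r) :
    ∫ x, (f x : ℝ) ∂(scaledLaw P (fun ω => ⇑(X 0 ω)) m s).1
        - k * (1 - ∫ ω, Real.exp (-∫ x, (f x : ℝ) ∂(empirical X k s m ω).1) ∂P) ≤
      C * (m * P.real ({ω | δ * s < ‖X 0 ω‖} ∩ {ω | δ * s < runMax X q l ω}))
        + r * ∫ x, (f x : ℝ) ∂(scaledLaw P (fun ω => ⇑(X 0 ω)) m s).1 := by
  set S : Ω → ℝ := fun ω => ∑ t ∈ Finset.Icc 1 m, extendZero f (toExt (s⁻¹ • ⇑(X (t : ℤ) ω)))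
  have hS : Measurable S := measurable_sum_extendZero hX f s m
  have hS0 : ∀ ω, 0 ≤ S ω := fun ω => Finset.sum_nonneg fun t _ => extendZero_nonneg f _
  have hSint : Integrable S P := integrable_finsetSum _ fun t _ =>
    integrable_extendZero_smul hX f s t
  have hexp : Integrable (fun ω => Real.exp (-((k : ℝ)⁻¹ * S ω))) P :=
    Integrable.of_bound (by fun_prop) 1 (ae_of_all _ fun ω => by
      have : 0 ≤ (k : ℝ)⁻¹ * S ω := mul_nonneg (by positivity) (hS0 ω)
      simpa [abs_of_pos (Real.exp_pos _)] using this)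
  simp_rw [integral_empirical]
  rw [← integral_sum_extendZero hX hstat]
  let D : Set (ℤ → EuclideanSpace ℝ (Fin d)) :=
    {x | δ * s < ‖x 0‖ ∧ ∃ i ∈ Finset.Icc q l, δ * s < ‖x (i : ℤ)‖}
  have hA : ∀ t : ℤ, MeasurableSet {x : ℤ → EuclideanSpace ℝ (Fin d) | δ * s < ‖x t‖} := fun t =>
    measurableSet_lt measurable_const (measurable_pi_apply t).norm
  have hD : MeasurableSet D := by
    have : D = {x | δ * s < ‖x 0‖} ∩ ⋃ i ∈ Finset.Icc q l, {x | δ * s < ‖x (i : ℤ)‖} := by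
      ext x; simp [D]
    rw [this]
    exact (hA 0).inter (Finset.measurableSet_biUnion _ fun i _ => hA i)
  let φ : (ℤ → EuclideanSpace ℝ (Fin d)) → ℝ := D.indicator 1
  have hφ : Measurable φ := measurable_one.indicator hD
  have hXs : ∀ t : ℤ, Measurable fun ω u => X (u + t) ω := fun t =>
    measurable_pi_lambda _ fun u => hX (u + t)
  have hφint : ∀ t : ℤ, Integrable (fun ω => φ fun u => X (u + t) ω) P := fun t =>
    Integrable.of_bound (hφ.comp (hXs t)).aestronglyMeasurable 1 (ae_of_all _ fun ω => by
      simp only [φ, Set.indicator_apply]; split_ifs <;> simp)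
  have hφP : ∀ t : ℤ, ∫ ω, φ (fun u => X (u + t) ω) ∂P ≤
      P.real ({ω | δ * s < ‖X 0 ω‖} ∩ {ω | δ * s < runMax X q l ω}) := by
    intro t
    rw [hstat.integral_shift hX hφ]
    have hpre : MeasurableSet ((fun ω u => X u ω) ⁻¹' D) :=
      (measurable_pi_lambda _ fun u => hX u) hD
    have : (fun ω => φ fun u => X u ω) = ((fun ω u => X u ω) ⁻¹' D).indicator 1 := rfl
    rw [this, integral_indicator_one hpre]
    refine measureReal_mono ?_
    rintro ω ⟨h0, i, hi, hlt⟩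
    refine ⟨h0, hlt.trans_le ?_⟩
    exact_mod_cast Finset.le_sup (f := fun i : ℕ => ‖X i ω‖₊) hi
  have hpt : ∀ ω, S ω - k * (1 - Real.exp (-((k : ℝ)⁻¹ * S ω))) ≤
      C * (∑ t ∈ Finset.Icc 1 m, φ fun u => X (u + (t : ℤ)) ω) + r * S ω := by
    intro ω
    refine (sum_sub_le_of_gap (fun t : ℕ => δ * s < ‖X t ω‖)
      (fun t : ℕ => extendZero f (toExt (s⁻¹ • ⇑(X t ω)))) hl hk hC0
      (fun t => extendZero_nonneg f _) (fun t => hC _)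
      (fun t => lt_norm_of_extendZero_ne_zero hδ hf s _) hr hr0).trans ?_
    gcongr with t _
    simp only [φ, Set.indicator_apply]
    split_ifs with h1 h2 h2
    · simp
    · refine absurd ⟨by simpa using h1.1, ?_⟩ h2
      obtain ⟨i, hi, hlt⟩ := h1.2
      rw [Finset.mem_Icc] at hi
      -- The subtraction is not truncated, since t + q ≤ i.
      refine ⟨i - t, Finset.mem_Icc.2 (by omega), ?_⟩
      have hi' : ((i - t : ℕ) : ℤ) + t = i := by omega
      simpa only [hi'] using hlt
    · simp
    · simp
  have hI := integral_mono
    (hSint.sub (((integrable_const 1).sub hexp).const_mul (k : ℝ)))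
    (((integrable_finsetSum _ fun (t : ℕ) _ => hφint t).const_mul C).add (hSint.const_mul r)) hpt
  have hlhs : ∫ ω, (S ω - k * (1 - Real.exp (-((k : ℝ)⁻¹ * S ω)))) ∂P =
      ∫ ω, S ω ∂P - k * (1 - ∫ ω, Real.exp (-((k : ℝ)⁻¹ * S ω)) ∂P) := by
    have h1 : ∫ ω, (1 - Real.exp (-((k : ℝ)⁻¹ * S ω))) ∂P =
        1 - ∫ ω, Real.exp (-((k : ℝ)⁻¹ * S ω)) ∂P := by
      rw [integral_sub (integrable_const 1) hexp]; simp
    rw [← h1, ← integral_const_mul]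
    exact integral_sub hSint (((integrable_const 1).sub hexp).const_mul (k : ℝ))
  have hrhs : ∫ ω, (C * (∑ t ∈ Finset.Icc 1 m, φ fun u => X (u + (t : ℤ)) ω) + r * S ω) ∂P =
      C * (∑ t ∈ Finset.Icc 1 m, ∫ ω, φ (fun u => X (u + (t : ℤ)) ω) ∂P) + r * ∫ ω, S ω ∂P := by
    rw [integral_add ((integrable_finsetSum _ fun (t : ℕ) _ => hφint t).const_mul C)
      (hSint.const_mul r), integral_const_mul, integral_const_mul,
      integral_finsetSum _ fun (t : ℕ) _ => hφint t]
  rw [← hlhs]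
  refine hI.trans (hrhs.le.trans ?_)
  gcongr
  refine (Finset.sum_le_sum fun (t : ℕ) _ => hφP t).trans ?_
  simp

lemma mul_one_sub_integral_le (hX : ∀ t, Measurable (X t)) (hstat : StrictlyStationary P X)
    (f : C_c(Punctured (Fin d), ℝ≥0)) (s : ℝ) {m k : ℕ} (hk : 0 < k) :
    k * (1 - ∫ ω, Real.exp (-∫ x, (f x : ℝ) ∂(empirical X k s m ω).1) ∂P) ≤
      ∫ x, (f x : ℝ) ∂(scaledLaw P (fun ω => ⇑(X 0 ω)) m s).1 := by
  rw [← integral_sum_extendZero hX hstat]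
  simp_rw [integral_empirical]
  set S : Ω → ℝ := fun ω => ∑ t ∈ Finset.Icc 1 m, extendZero f (toExt (s⁻¹ • ⇑(X (t : ℤ) ω)))
  have hS : Measurable S := measurable_sum_extendZero hX f s m
  have hS0 : ∀ ω, 0 ≤ S ω := fun ω => Finset.sum_nonneg fun t _ => extendZero_nonneg f _
  have hSint : Integrable S P := integrable_finsetSum _ fun t _ =>
    integrable_extendZero_smul hX f s t
  have hexp : Integrable (fun ω => Real.exp (-((k : ℝ)⁻¹ * S ω))) P :=
    Integrable.of_bound (by fun_prop) 1 (ae_of_all _ fun ω => by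
      have : 0 ≤ (k : ℝ)⁻¹ * S ω := mul_nonneg (by positivity) (hS0 ω)
      simpa [abs_of_pos (Real.exp_pos _)] using this)
  have hk' : (0 : ℝ) < k := by exact_mod_cast hk
  have hI := integral_mono ((integrable_const (1 : ℝ)).sub hexp) (hSint.const_mul (k : ℝ)⁻¹)
    fun ω => by
      have := Real.add_one_le_exp (-((k : ℝ)⁻¹ * S ω))
      simp only [Pi.sub_apply]
      linarith
  rw [integral_sub' (integrable_const 1) hexp, integral_const_mul] at hI
  rw [← le_inv_mul_iff₀ hk']
  simpa using hI

end Block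

/-! ### Passage to the limit. -/

section Limit

variable {Ω : Type*} [MeasurableSpace Ω] {P : Measure Ω} [IsProbabilityMeasure P] {d : ℕ}
  {X : ℤ → Ω → EuclideanSpace ℝ (Fin d)} {a : ℕ → ℝ}

/-- The exceedance probability tends to 0 but is eventually positive. A negative level would give
probability 1, and a zero level the fixed value P(|X_0| > 0). -/
lemma eventually_pos_of_tendsto
    (h : Tendsto (fun n : ℕ => (n : ℝ) * P.real {ω | a n < ‖X 0 ω‖}) atTop (𝓝 1)) :
    ∀ᶠ n in atTop, 0 < a n := by
  have hp : Tendsto (fun n : ℕ => P.real {ω | a n < ‖X 0 ω‖}) atTop (𝓝 0) := by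
    have h1 := h.mul tendsto_inv_atTop_nhds_zero_nat
    rw [mul_zero] at h1
    refine h1.congr' ?_
    filter_upwards [eventually_gt_atTop 0] with n hn
    have : (n : ℝ) ≠ 0 := by positivity
    field_simp
  have hlt : ∀ᶠ n : ℕ in atTop, 0 < P.real {ω | 0 < ‖X 0 ω‖} →
      P.real {ω | a n < ‖X 0 ω‖} < P.real {ω | 0 < ‖X 0 ω‖} := by
    by_cases h0 : 0 < P.real {ω | 0 < ‖X 0 ω‖}
    · filter_upwards [hp.eventually_lt_const h0] with n hn _ using hn
    · exact Eventually.of_forall fun n h => absurd h h0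
  filter_upwards [hp.eventually_lt_const one_pos, h.eventually_const_lt one_pos, hlt]
    with n h1 h2 h3
  by_contra! hle
  rcases hle.lt_or_eq with hneg | hzero
  · have : {ω | a n < ‖X 0 ω‖} = Set.univ :=
      Set.eq_univ_of_forall fun ω => hneg.trans_le (norm_nonneg _)
    rw [this] at h1
    simp at h1
  · rw [hzero] at h2 h3
    exact lt_irrefl _ (h3 (pos_of_mul_pos_right h2 (Nat.cast_nonneg n)))

/-- A compactly supported function dominates the indicator of the exceedance set, and its scaled
integrals converge. -/
lemma exists_eventually_mul_measureReal_le (hX : ∀ t, Measurable (X t))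
    (ha : ∀ᶠ n in atTop, 0 < a n) {μ : RadonMeasure (Punctured (Fin d))}
    (hμ : Tendsto (fun n : ℕ => scaledLaw P (fun ω => ⇑(X 0 ω)) n (a n)) atTop (𝓝 μ))
    {δ : ℝ} (hδ : 0 < δ) :
    ∃ D : ℝ, 0 ≤ D ∧ ∀ᶠ n : ℕ in atTop, n * P.real {ω | δ * a n < ‖X 0 ω‖} ≤ D := by
  obtain ⟨g, hg⟩ := exists_one_le_extendZero (d := d) hδ
  have hlim := tendsto_radonMeasure_iff.1 hμ g
  refine ⟨∫ x, (g x : ℝ) ∂μ.1 + 1, by positivity, ?_⟩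
  filter_upwards [hlim.eventually_lt_const (lt_add_one _), ha] with n hn hpos
  refine le_trans ?_ hn.le
  rw [integral_scaledLaw P (measurable_ofLp (hX 0))]
  have hms : MeasurableSet {ω | δ * a n < ‖X 0 ω‖} :=
    measurableSet_lt measurable_const (hX 0).norm
  rw [← integral_indicator_one hms, NNReal.coe_natCast]
  refine mul_le_mul_of_nonneg_left ?_ (Nat.cast_nonneg n)
  refine integral_mono ((integrable_const (1 : ℝ)).indicator hms)
    (integrable_extendZero_smul hX g (a n) 0) fun ω => ?_
  refine Set.indicator_apply_le' (fun hω => ?_) fun _ => extendZero_nonneg g _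
  refine hg ((a n)⁻¹ • X 0 ω) ?_
  rw [norm_smul, norm_inv, Real.norm_of_nonneg hpos.le, lt_inv_mul_iff₀ hpos, mul_comm]
  exact hω

lemma AntiClustering.exists_eventually_le {l : ℕ → ℕ} (hAC : AntiClustering P X a l)
    (hX : ∀ t, Measurable (X t)) {δ : ℝ} (hδ : 0 < δ) {η : ℝ} (hη : 0 < η) :
    ∃ q : ℕ, ∀ᶠ n in atTop,
      P.real ({ω | δ * a n < ‖X 0 ω‖} ∩ {ω | δ * a n < runMax X q (l n) ω}) ≤
        η * P.real {ω | δ * a n < ‖X 0 ω‖} := by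
  obtain ⟨q, hq⟩ :=
    ((hAC δ hδ).eventually_lt_const (ENNReal.ofReal_pos.2 hη)).exists
  refine ⟨q, ?_⟩
  filter_upwards [eventually_lt_of_limsup_lt hq] with n hn
  have hms : MeasurableSet {ω | δ * a n < ‖X 0 ω‖} :=
    measurableSet_lt measurable_const (hX 0).norm
  have h := cond_mul_eq_inter hms {ω | δ * a n < runMax X q (l n) ω} P
  rw [measureReal_def, measureReal_def, ← h, ENNReal.toReal_mul]
  gcongr
  exact ENNReal.toReal_le_of_le_ofReal hη.le hn.le

/-- The core limit: the block mean `e n` tends to c, and its difference from `u n` is squeezed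
between 0 and the clustering and quadratic errors. -/
lemma tendsto_mul_one_sub_laplace (hX : ∀ t, Measurable (X t)) (hstat : StrictlyStationary P X)
    (ha : ∀ᶠ n in atTop, 0 < a n) {μ : RadonMeasure (Punctured (Fin d))}
    (hμ : Tendsto (fun n : ℕ => scaledLaw P (fun ω => ⇑(X 0 ω)) n (a n)) atTop (𝓝 μ))
    {m l : ℕ → ℕ} (hm : Tendsto m atTop atTop) (hk : Tendsto (fun n => n / m n) atTop atTop)
    (hl : Tendsto (fun n : ℕ => ((n / m n : ℕ) : ℝ) * (l (m n) : ℝ) / (m n : ℝ)) atTop atTop)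
    (hAC : AntiClustering P X a l) (f : C_c(Punctured (Fin d), ℝ≥0)) :
    Tendsto (fun n : ℕ => ((n / m n : ℕ) : ℝ) *
        (1 - ∫ ω, Real.exp (-∫ x, (f x : ℝ) ∂(tailEmpirical X a m n (m n) ω).1) ∂P)) atTop
      (𝓝 (∫ x, (f x : ℝ) ∂μ.1)) := by
  set c := ∫ x, (f x : ℝ) ∂μ.1
  have hc : 0 ≤ c := by positivity
  set e : ℕ → ℝ := fun n =>
    ∫ x, (f x : ℝ) ∂(scaledLaw P (fun ω => ⇑(X 0 ω)) (m n : ℕ) (a (m n))).1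
  have he : Tendsto e atTop (𝓝 c) := (tendsto_radonMeasure_iff.1 hμ f).comp hm
  set u : ℕ → ℝ := fun n => ((n / m n : ℕ) : ℝ) *
    (1 - ∫ ω, Real.exp (-∫ x, (f x : ℝ) ∂(tailEmpirical X a m n (m n) ω).1) ∂P)
  suffices hdiff : Tendsto (fun n => e n - u n) atTop (𝓝 0) by
    simpa using he.sub hdiff
  have hkR : Tendsto (fun n => ((n / m n : ℕ) : ℝ)) atTop atTop :=
    tendsto_natCast_atTop_atTop.comp hk
  obtain ⟨C, hC0, hC⟩ := exists_extendZero_le f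
  obtain ⟨δ, hδ, hf⟩ := exists_lt_norm_of_extendZero_ne_zero f
  obtain ⟨D, hD0, hD⟩ := exists_eventually_mul_measureReal_le hX ha hμ hδ
  refine tendsto_order.2 ⟨fun b hb => ?_, fun ε hε => ?_⟩
  · filter_upwards [hk.eventually_gt_atTop 0] with n hn
    exact hb.trans_le (sub_nonneg.2 (mul_one_sub_integral_le hX hstat f _ hn))
  -- `η` and `r` make the clustering and quadratic errors at most ε/4 each; the +1 avoids division
  -- by zero.
  set η := ε / (4 * (C * D + 1))
  have hη : 0 < η := by positivity
  set r := ε / (4 * (c + 1))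
  have hr : 0 < r := by positivity
  obtain ⟨q, hq⟩ := hAC.exists_eventually_le hX hδ hη
  -- This dominates Cq(m/l + 1)/k; it vanishes thanks to the growth of kl/m and of k.
  have hsmall : Tendsto (fun n : ℕ => C * (q * ((((n / m n : ℕ) : ℝ) * (l (m n) : ℝ) / (m n : ℝ))⁻¹
      + ((n / m n : ℕ) : ℝ)⁻¹))) atTop (𝓝 0) := by
    simpa using ((hl.inv_tendsto_atTop.add hkR.inv_tendsto_atTop).const_mul (q : ℝ)).const_mul C
  filter_upwards [hk.eventually_gt_atTop 0, hl.eventually_gt_atTop 0,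
    hsmall.eventually_lt_const hr, hm.eventually hD, hm.eventually hq,
    he.eventually_lt_const (lt_add_one c)] with n hkn hln hsn hDn hqn hen
  have hk0 : (0 : ℝ) < ((n / m n : ℕ) : ℝ) := by exact_mod_cast hkn
  have hl0 : 0 < l (m n) := by
    rcases Nat.eq_zero_or_pos (l (m n)) with h | h
    · simp [h] at hln
    · exact h
  have hl0' : (0 : ℝ) < l (m n) := by exact_mod_cast hl0
  have hrk : C * (q * (m n / l (m n) + 1) : ℕ) ≤ r * ((n / m n : ℕ) : ℝ) := by
    have hdiv : ((m n / l (m n) : ℕ) : ℝ) ≤ (m n : ℝ) / l (m n) := Nat.cast_div_le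
    calc C * ((q * (m n / l (m n) + 1) : ℕ) : ℝ)
        ≤ C * (q * ((m n : ℝ) / l (m n) + 1)) := by push_cast; gcongr
      _ = C * (q * ((((n / m n : ℕ) : ℝ) * (l (m n) : ℝ) / (m n : ℝ))⁻¹
            + ((n / m n : ℕ) : ℝ)⁻¹)) * ((n / m n : ℕ) : ℝ) := by
          rw [inv_div]; field_simp
      _ ≤ r * ((n / m n : ℕ) : ℝ) := by gcongr
  have hmain := integral_sub_le_of_block hX hstat hC0 hC hδ hf (a (m n)) hl0 hkn hrk hr.le
  have h1 : C * (m n * P.real ({ω | δ * a (m n) < ‖X 0 ω‖} ∩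
      {ω | δ * a (m n) < runMax X q (l (m n)) ω})) ≤ ε / 4 := by
    calc _ ≤ C * (m n * (η * P.real {ω | δ * a (m n) < ‖X 0 ω‖})) := by gcongr
      _ = C * η * (m n * P.real {ω | δ * a (m n) < ‖X 0 ω‖}) := by ring
      _ ≤ C * η * D := by gcongr
      _ = (ε / 4) * ((C * D) / (C * D + 1)) := by simp only [η]; field_simp
      _ ≤ (ε / 4) * 1 := by
          gcongr
          rw [div_le_one (by positivity)]
          linarith
      _ = ε / 4 := mul_one _
  have h2 : r * e n ≤ ε / 4 := by
    calc r * e n ≤ r * (c + 1) := by gcongr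
      _ = ε / 4 := by simp only [r]; field_simp
  calc e n - u n ≤ _ := hmain
    _ ≤ ε / 4 + ε / 4 := add_le_add h1 h2
    _ < ε := by linarith

end Limit

end TailEmpirical

open TailEmpirical in
theorem theorem4p9 {Ω : Type*} [MeasurableSpace Ω] (P : Measure Ω) [IsProbabilityMeasure P]
    {d : ℕ} (X : ℤ → Ω → EuclideanSpace ℝ (Fin d)) (hX : ∀ t, Measurable (X t))
    (hstat : StrictlyStationary P X)
    (α : ℝ) (hα : 0 < α) (a : ℕ → ℝ) (hRV : RegularlyVarying P X α a)
    (m : ℕ → ℕ) (hm : Tendsto m atTop atTop) (hk : Tendsto (fun n => n / m n) atTop atTop)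
    (hmix : Mixing P X a m)
    (l : ℕ → ℕ)
    (hl : Tendsto (fun n : ℕ => ((n / m n : ℕ) : ℝ) * (l (m n) : ℝ) / (m n : ℝ)) atTop atTop)
    (hAC : AntiClustering P X a l) :
    ∃ μ₁ : RadonMeasure (Punctured (Fin d)),
      Tendsto (fun n : ℕ => scaledLaw P (fun ω => ⇑(X 0 ω)) n (a n)) atTop (𝓝 μ₁) ∧
      ConvergesInProbability P (fun n => tailEmpirical X a m n n) μ₁ := by
  obtain ⟨μ, -, -, hμ⟩ := hRV.2 1 le_rfl
  obtain ⟨μ₁, hμ₁⟩ := exists_tendsto_scaledLaw P X hX (hstat.map_eq hX 1) a hμ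
  refine ⟨μ₁, hμ₁, convergesInProbability_of_integral fun f ε hε => ?_⟩
  have ha := eventually_pos_of_tendsto hRV.1
  have hlaplace : ∀ g : C_c(Punctured (Fin d), ℝ≥0),
      Tendsto (fun n => ∫ ω, Real.exp (-∫ x, (g x : ℝ) ∂(tailEmpirical X a m n n ω).1) ∂P) atTop
        (𝓝 (Real.exp (-∫ x, (g x : ℝ) ∂μ₁.1))) := fun g => by
    have h := (hmix g).add (tendsto_pow_exp_neg hk
      (tendsto_mul_one_sub_laplace hX hstat ha hμ₁ hm hk hl hAC g))
    simpa using h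
  -- Doubling the test function gives the Laplace transform at 2.
  have hdouble : ∀ ν : Measure (Punctured (Fin d)),
      ∫ x, ((f + f) x : ℝ) ∂ν = 2 * ∫ x, (f x : ℝ) ∂ν := fun ν => by
    rw [← integral_const_mul]
    refine integral_congr_ae (ae_of_all _ fun x => ?_)
    simp [two_mul]
  refine tendsto_measure_of_laplace (fun n => ?_) (fun n ω => by positivity) (hlaplace f) ?_ hε
  · simp only [tailEmpirical, integral_empirical]
    exact (measurable_sum_extendZero hX f _ n).const_mul _
  · simpa only [hdouble] using hlaplace (f + f)
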